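/- There is an absolute constant $c>0$ such that the following holds. Let $n\ge 3$, $s\ge 1$, $m\ge 1$ be integers and let $F(x,y)\in\mathbb{Z}[x,y]$ be a binary form of degree $n$ that is irreducible over $\mathbb{Q}$ and lies in $C(4s-2)$, i.e. for all reals $(u,v)\neq(0,0)$ the form $uF_x+vF_y$ has at most $4s-2$ distinct real zeros in $\mathbb{P}^1(\mathbb{R})$. Write $F(x,y)=a_n\prod_{i=1}^n(x-\gamma_i y)$ with $\gamma_i\in\mathbb{C}$, let $D(F)=a_n^{2(n-1)}\prod_{i<j}(\gamma_i-\gamma_j)^2$ be its discriminant and $M=M(F)=|a_n|\prod_{i}\max(1,|\gamma_i|)$ its Mahler measure. Assume that $F$ has minimal Mahler measure, i.e. $M(F)\le M(G)$ for every form $G(x,y)=\pm F(ax+by,cx+dy)$ with $\begin{pmatrix}a&b\\c&d\end{pmatrix}\in \mathrm{GL}_2(\mathbb{Z})$, that $$|D(F)|>(n(n-1))^{8n(n-1)},$$ and that $$m\le \frac{|D(F)|^{\frac1{2(n-1)}}}{e^{200n}}.$$ Then the number of pairs $(x,y)\in\mathbb{Z}^2$ with $\gcd(x,y)=1$ (primitive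 solutions) that satisfy $$2^{-n}m\le F(x,y)<m\qquad\text{and}\qquad 0\le y\le (M/m)^5$$ is at most $c\,n$. -/

import Mathlib

/-- The ring `ℤ[x, y]`, with `x = X 0` and `y = X 1`, in which integral binary forms live
(homogeneity is imposed separately). -/
abbrev BinForm : Type := MvPolynomial (Fin 2) ℤ

namespace BinForm

noncomputable section

/-- The polynomial `F(z, 1)`, with complex coefficients. For `F = a_n x^n + ⋯ + a_0 y^n` with
`a_n ≠ 0` it is `a_n (z - γ_1) ⋯ (z - γ_n)`. -/
def dehom (F : BinForm) : Polynomial ℂ :=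
  MvPolynomial.aeval ![(Polynomial.X : Polynomial ℂ), 1] F

/-- The discriminant `a_n ^ (2 (n - 1)) ∏_{i < j} (γ_i - γ_j) ^ 2`, where `a_n` is the leading
coefficient, `n` the degree and `γ_1, …, γ_n` are the complex roots, listed with multiplicity,
of `F(z, 1)`. (The differences are squared, so the order of the list is irrelevant. The form `F`
is meant to have `a_n ≠ 0`, as every irreducible form of degree at least `2` does.) -/
def discr (F : BinForm) : ℂ :=
  F.dehom.leadingCoeff ^ (2 * (F.dehom.natDegree - 1)) *
    ∏ i : Fin F.dehom.roots.toList.length, ∏ j ∈ Finset.Ioi i,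
      (F.dehom.roots.toList.get i - F.dehom.roots.toList.get j) ^ 2

/-- The Mahler measure `|a_n| ∏ max (1, |γ_i|)`
(see `Polynomial.mahlerMeasure_eq_leadingCoeff_mul_prod_roots`). -/
def mahler (F : BinForm) : ℝ := F.dehom.mahlerMeasure

/-- The form `F_A(x, y) = F(ax + by, cx + dy)` for `A = (a, b; c, d)`. -/
def subst (A : Matrix (Fin 2) (Fin 2) ℤ) (F : BinForm) : BinForm :=
  MvPolynomial.bind₁ (fun i : Fin 2 =>
    MvPolynomial.C (A i 0) * MvPolynomial.X 0 + MvPolynomial.C (A i 1) * MvPolynomial.X 1) F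

/-- `F` and `G` are equivalent: `G = ± F_A` for some `A ∈ GL₂(ℤ)`. -/
def Equivalent (F G : BinForm) : Prop :=
  ∃ A : Matrix.GeneralLinearGroup (Fin 2) ℤ,
    G = subst (A : Matrix (Fin 2) (Fin 2) ℤ) F ∨ G = -subst (A : Matrix (Fin 2) (Fin 2) ℤ) F

/-- `F` has the smallest Mahler measure among all forms equivalent to it. -/
def HasMinimalMahler (F : BinForm) : Prop :=
  ∀ G : BinForm, F.Equivalent G → F.mahler ≤ G.mahler

/-- The real form `u F_x + v F_y`. -/
def dirDeriv (F : BinForm) (u v : ℝ) : MvPolynomial (Fin 2) ℝ :=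
  MvPolynomial.C u * MvPolynomial.map (Int.castRingHom ℝ) (MvPolynomial.pderiv 0 F) +
    MvPolynomial.C v * MvPolynomial.map (Int.castRingHom ℝ) (MvPolynomial.pderiv 1 F)

/-- The real zeros of a real binary form `G`, as points of the real projective line. -/
def realZeros (G : MvPolynomial (Fin 2) ℝ) : Set (Projectivization ℝ (Fin 2 → ℝ)) :=
  {P | MvPolynomial.eval P.rep G = 0}

/-- The class `C(t)` (for the degree `n`): forms of degree `n` with integer coefficients,
irreducible over `ℚ`, such that for all reals `(u, v) ≠ (0, 0)` the form `u F_x + v F_y` has at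
most `t` real zeros. -/
def classC (n t : ℕ) : Set BinForm :=
  {F | F.IsHomogeneous n ∧ Irreducible (MvPolynomial.map (Int.castRingHom ℚ) F) ∧
    ∀ u v : ℝ, (u, v) ≠ (0, 0) → (realZeros (F.dirDeriv u v)).encard ≤ t}

/-- The value `F(x, y)` at an integer point. -/
def value (F : BinForm) (x y : ℤ) : ℤ := MvPolynomial.eval ![x, y] F

/-- The primitive integer solutions `(x, y)` of `2⁻ⁿ m ≤ F(x, y) < m` that are small, that is,
`0 ≤ y ≤ (M / m) ^ 5`, where `M` is the Mahler measure of `F`. -/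
def smallSolutions (n m : ℕ) (F : BinForm) : Set (ℤ × ℤ) :=
  {p | Int.gcd p.1 p.2 = 1 ∧
    (m : ℝ) / 2 ^ n ≤ (F.value p.1 p.2 : ℝ) ∧ (F.value p.1 p.2 : ℝ) < m ∧
    0 ≤ p.2 ∧ (p.2 : ℝ) ≤ (F.mahler / m) ^ 5}

end

end BinForm

namespace BinForm

/-! Write L_i(p) = x - γ_i y and K = M / m. A primitive p = (x, y) with y > 0 is the first column of
some A in SL₂(ℤ). The form F_A has leading coefficient F(p), and its roots have absolute value at
most 1 + 1 / (y |L_i(p)|). Minimality of M then gives K ≤ 3 ^ n ∏_i v_i(p) for every solution p,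
where v_i(p) = max(1, 1 / (2 y |L_i(p)|)) (`mahler_le_value_mul_prod_closeness`).

Conversely, two points close to the same root lie far apart: v_i(p) ≤ y_q / y_p if y_p ≤ y_q and
v_i(q) > 1 (`closeness_le_div`). For fixed i these ratios telescope, so ∏_p v_i(p) ≤ K ^ 5 once the
last close point is left out. Discarding at most n points in all, the remaining r satisfy K ^ r ≤ 3
^ (n r) K ^ (5 n). Since K ≥ 9 ^ n (`nine_pow_le_mahler_div`), r ≤ 10 n (`card_le_of_gap`). The
points with y = 0 add at most two. -/

/-! ### Dehomogenisation and factorisation over ℂ. -/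

theorem eq_add_of_mem_support {R : Type*} [CommSemiring R] {n : ℕ} {F : MvPolynomial (Fin 2) R}
    (hF : F.IsHomogeneous n) {d : Fin 2 →₀ ℕ} (hd : d ∈ F.support) : n = d 0 + d 1 := by
  refine (hF.degree_eq_sum_deg_support hd).trans ?_
  exact (Finsupp.sum_fintype d (fun _ k => k) fun _ => rfl).trans (Fin.sum_univ_two _)

open MvPolynomial in
/-- A homogeneous irreducible form of degree at least two contains the monomial `x ^ n`. -/
theorem coeff_single_ne_zero {n : ℕ} {F : BinForm} (hn : 2 ≤ n) (hF : F.IsHomogeneous n)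
    (hirr : Irreducible (map (Int.castRingHom ℚ) F)) :
    coeff (Finsupp.single 0 n) F ≠ 0 := by
  intro h0
  set G := map (Int.castRingHom ℚ) F with hG
  have hGhom : G.IsHomogeneous n := hF.map _
  -- If `x ^ n` is absent, every monomial contains `y`; an irreducible form divisible by `y` has
  -- degree one.
  have hdvd : (X 1 : MvPolynomial (Fin 2) ℚ) ∣ G := by
    rw [G.as_sum]
    refine Finset.dvd_sum fun d hd => ?_
    rw [X_dvd_monomial]
    refine Or.inr fun hd1 => ?_
    have hdeg := eq_add_of_mem_support hGhom hd
    have hd0 : d = Finsupp.single 0 n := by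
      ext i
      fin_cases i
      · simp; omega
      · simpa using hd1
    rw [mem_support_iff, hd0, hG, coeff_map, h0] at hd
    simp at hd
  obtain ⟨g, hg⟩ := hdvd
  have hX : ¬ IsUnit (X 1 : MvPolynomial (Fin 2) ℚ) := fun h => by
    have := (isUnit_iff_totalDegree_of_isReduced.mp h).2
    simp at this
  have hgu : IsUnit g := (hirr.isUnit_or_isUnit hg).resolve_left hX
  have hg0 := (isUnit_iff_totalDegree_of_isReduced.mp hgu).2
  have htot := hGhom.totalDegree hirr.ne_zero
  rw [hg, totalDegree_mul_of_isDomain (X_ne_zero 1) hgu.ne_zero, hg0] at htot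
  simp at htot
  omega

theorem eval_dehom (F : BinForm) (z : ℂ) :
    F.dehom.eval z = MvPolynomial.aeval ![z, 1] F := by
  rw [dehom, ← Polynomial.coe_aeval_eq_eval]
  have : ((Polynomial.aeval z : Polynomial ℂ →ₐ[ℂ] ℂ).toRingHom.comp
      (MvPolynomial.aeval ![(Polynomial.X : Polynomial ℂ), 1] : BinForm →ₐ[ℤ] _).toRingHom) =
      (MvPolynomial.aeval ![z, 1] : BinForm →ₐ[ℤ] ℂ).toRingHom := by
    apply MvPolynomial.ringHom_ext
    · intro r; simp
    · intro i; fin_cases i <;> simp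
  exact congrArg (fun f => f F) this

theorem natDegree_dehom {n : ℕ} {F : BinForm} (hF : F.IsHomogeneous n)
    (h0 : MvPolynomial.coeff (Finsupp.single 0 n) F ≠ 0) : F.dehom.natDegree = n := by
  have hsum : F.dehom = ∑ d ∈ F.support,
      Polynomial.C ((MvPolynomial.coeff d F : ℤ) : ℂ) * Polynomial.X ^ (d 0) := by
    rw [dehom, MvPolynomial.aeval_def, MvPolynomial.eval₂_eq']
    refine Finset.sum_congr rfl fun d _ => ?_
    simp [Fin.prod_univ_two]
  have hdeg : ∀ d ∈ F.support, n = d 0 + d 1 := fun d hd =>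
    eq_add_of_mem_support hF hd
  apply le_antisymm
  · rw [hsum]
    refine Polynomial.natDegree_sum_le_of_forall_le _ _ fun d hd => ?_
    refine (Polynomial.natDegree_C_mul_X_pow_le _ _).trans ?_
    have := hdeg d hd
    omega
  · apply Polynomial.le_natDegree_of_ne_zero
    rw [hsum, Polynomial.finsetSum_coeff, Finset.sum_eq_single (Finsupp.single 0 n)]
    · simpa using h0
    · intro d hd hne
      rw [Polynomial.coeff_C_mul_X_pow, if_neg]
      intro h
      apply hne
      have := hdeg d hd
      ext i
      fin_cases i
      · simp [h]
      · simp; omega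
    · intro h
      exact absurd (MvPolynomial.mem_support_iff.mpr h0) h

/-- The roots `γ_i` of `F(z, 1)`. -/
noncomputable def root (F : BinForm) (i : Fin F.dehom.roots.toList.length) : ℂ :=
  F.dehom.roots.toList.get i

theorem length_roots (F : BinForm) : F.dehom.roots.toList.length = F.dehom.natDegree := by
  rw [Multiset.length_toList]
  exact (IsAlgClosed.splits F.dehom).natDegree_eq_card_roots.symm

theorem prod_map_roots {M : Type*} [CommMonoid M] (F : BinForm) (f : ℂ → M) :
    (F.dehom.roots.map f).prod = ∏ i, f (F.root i) := by
  conv_lhs => rw [← Multiset.coe_toList F.dehom.roots]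
  rw [Multiset.map_coe, Multiset.prod_coe, ← List.prod_ofFn]
  congr 1
  conv_lhs => rw [← List.ofFn_get F.dehom.roots.toList, List.map_ofFn]
  rfl

theorem mahler_eq (F : BinForm) :
    F.mahler = ‖F.dehom.leadingCoeff‖ * ∏ i, max 1 ‖F.root i‖ := by
  rw [mahler, Polynomial.mahlerMeasure_eq_leadingCoeff_mul_prod_roots,
    prod_map_roots F (fun a => max 1 ‖a‖)]

theorem aeval_eq_pow_mul {n : ℕ} {F : BinForm} (hF : F.IsHomogeneous n) (u v : ℂ) (hv : v ≠ 0) :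
    MvPolynomial.aeval ![u, v] F = v ^ n * F.dehom.eval (u / v) := by
  rw [eval_dehom, MvPolynomial.aeval_def, MvPolynomial.aeval_def, MvPolynomial.eval₂_eq',
    MvPolynomial.eval₂_eq', Finset.mul_sum]
  refine Finset.sum_congr rfl fun d hd => ?_
  have hd : n = d 0 + d 1 := eq_add_of_mem_support hF hd
  simp only [Fin.prod_univ_two, Matrix.cons_val_zero, Matrix.cons_val_one, one_pow, mul_one, hd,
    pow_add, div_pow]
  field_simp

theorem aeval_eq_prod {F : BinForm} (hF : F.IsHomogeneous F.dehom.natDegree) (u v : ℂ)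
    (hv : v ≠ 0) :
    MvPolynomial.aeval ![u, v] F = F.dehom.leadingCoeff * ∏ i, (u - F.root i * v) := by
  rw [aeval_eq_pow_mul hF u v hv, (IsAlgClosed.splits F.dehom).eval_eq_prod_roots,
    prod_map_roots F (fun a => u / v - a)]
  have : v ^ F.dehom.natDegree = ∏ i : Fin F.dehom.roots.toList.length, v := by
    rw [Finset.prod_const, Finset.card_univ, Fintype.card_fin, length_roots]
  rw [this, mul_left_comm, ← Finset.prod_mul_distrib]
  congr 1
  refine Finset.prod_congr rfl fun i _ => ?_
  field_simp

theorem value_eq_aeval (F : BinForm) (x y : ℤ) :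
    ((F.value x y : ℤ) : ℂ) = MvPolynomial.aeval ![(x : ℂ), (y : ℂ)] F := by
  have : ((Int.castRingHom ℂ).comp (MvPolynomial.eval ![x, y])) =
      (MvPolynomial.aeval ![(x : ℂ), (y : ℂ)] : BinForm →ₐ[ℤ] ℂ).toRingHom := by
    apply MvPolynomial.ringHom_ext
    · intro r; simp
    · intro i; fin_cases i <;> simp
  exact congrArg (fun f => f F) this

theorem eval_dehom_subst (A : Matrix (Fin 2) (Fin 2) ℤ) (F : BinForm) (z : ℂ) :
    (subst A F).dehom.eval z =
      MvPolynomial.aeval ![(A 0 0 : ℂ) * z + A 0 1, (A 1 0 : ℂ) * z + A 1 1] F := by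
  rw [eval_dehom]
  have : (MvPolynomial.aeval ![z, 1] : BinForm →ₐ[ℤ] ℂ).toRingHom.comp
      (MvPolynomial.bind₁ (fun i : Fin 2 =>
        MvPolynomial.C (A i 0) * MvPolynomial.X 0 +
          MvPolynomial.C (A i 1) * MvPolynomial.X 1) : BinForm →ₐ[ℤ] BinForm).toRingHom =
      (MvPolynomial.aeval ![(A 0 0 : ℂ) * z + A 0 1, (A 1 0 : ℂ) * z + A 1 1] :
        BinForm →ₐ[ℤ] ℂ).toRingHom := by
    apply MvPolynomial.ringHom_ext
    · intro r; simp
    · intro i; fin_cases i <;> simp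
  exact congrArg (fun f => f F) this

/-! ### Discriminant against Mahler measure. -/

/-- The discriminant is bounded in terms of the Mahler measure. -/
theorem norm_discr_le (F : BinForm) (hd : 1 ≤ F.dehom.natDegree) :
    ‖F.discr‖ ≤ (2 ^ F.dehom.natDegree * F.mahler) ^ (2 * (F.dehom.natDegree - 1)) := by
  set N := F.dehom.natDegree with hN
  have hlen := F.length_roots
  set b : Fin F.dehom.roots.toList.length → ℝ := fun i => 2 * max 1 ‖F.root i‖ with hb
  have hpair : ∀ i j, ‖F.root i - F.root j‖ ≤ b i * b j := fun i j => by
    refine (norm_sub_le _ _).trans ?_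
    have h1 := le_max_left 1 ‖F.root i‖
    have h2 := le_max_right 1 ‖F.root i‖
    have h3 := le_max_left 1 ‖F.root j‖
    have h4 := le_max_right 1 ‖F.root j‖
    simp only [hb]
    nlinarith [mul_nonneg (sub_nonneg.2 h1) (sub_nonneg.2 h3)]
  have hprod : ∏ i, ∏ j ∈ Finset.Ioi i, (b i * b j) ^ 2 = (∏ i, b i) ^ (2 * (N - 1)) := by
    -- Each index occurs in N - 1 pairs, as the smaller or as the larger member; the swap collects
    -- both kinds.
    have hswap : ∏ i, ∏ j ∈ Finset.Ioi i, b j = ∏ j, ∏ i ∈ Finset.Iio j, b j :=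
      Finset.prod_comm' (by simp)
    simp only [Finset.prod_pow, Finset.prod_mul_distrib]
    rw [hswap, ← Finset.prod_mul_distrib, ← Finset.prod_pow, ← Finset.prod_pow]
    refine Finset.prod_congr rfl fun i _ => ?_
    rw [Finset.prod_const, Finset.prod_const, ← pow_add, ← pow_mul, Fin.card_Ioi, Fin.card_Iio]
    congr 1
    have := i.2
    omega
  have hbM : ‖F.dehom.leadingCoeff‖ * ∏ i, b i = 2 ^ N * F.mahler := by
    rw [mahler_eq, Finset.prod_mul_distrib, Finset.prod_const, Finset.card_univ, Fintype.card_fin,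
      hN, ← hlen]
    ring
  rw [← hbM, mul_pow, ← hprod, discr, norm_mul, norm_pow, norm_prod]
  refine mul_le_mul_of_nonneg_left ?_ (by positivity)
  refine Finset.prod_le_prod (fun _ _ => norm_nonneg _) fun i _ => ?_
  rw [norm_prod]
  refine Finset.prod_le_prod (fun _ _ => norm_nonneg _) fun j _ => ?_
  rw [norm_pow]
  exact pow_le_pow_left₀ (norm_nonneg _) (hpair i j) 2

/-! ### Minimality forces closeness to the roots. -/

/-- The factor of `F` at the point `p` belonging to the `i`-th root. -/
noncomputable def linFactor (F : BinForm) (i : Fin F.dehom.roots.toList.length) (p : ℤ × ℤ) : ℂ :=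
  p.1 - F.root i * p.2

/-- A truncated measure of how well `p` approximates the `i`-th root of `F`. -/
noncomputable def closeness (F : BinForm) (i : Fin F.dehom.roots.toList.length) (p : ℤ × ℤ) : ℝ :=
  max 1 (1 / (2 * p.2 * ‖F.linFactor i p‖))

/-- Reducing the Bézout coefficient modulo `y` keeps `y' / y` in [0, 1), so that the roots of the
transformed form are governed by closeness alone. -/
theorem exists_basis_completion {x y : ℤ} (hy : 0 < y) (h : Int.gcd x y = 1) :
    ∃ x' y' : ℤ, x * y' - x' * y = 1 ∧ 0 ≤ y' ∧ y' < y := by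
  obtain ⟨u, v, huv⟩ := Int.isCoprime_iff_gcd_eq_one.mpr h
  refine ⟨-(v + x * (u / y)), u % y, ?_, Int.emod_nonneg _ hy.ne', Int.emod_lt_of_pos _ hy⟩
  have := Int.emod_add_mul_ediv u y
  linear_combination huv + x * this

/-- Minimality of the Mahler measure forces primitive points with small value to be close to
the roots. -/
theorem mahler_le_value_mul_prod_closeness {F : BinForm}
    (hF : F.IsHomogeneous F.dehom.natDegree) (hmin : F.HasMinimalMahler) {p : ℤ × ℤ}
    (hy : 0 < p.2) (hp : Int.gcd p.1 p.2 = 1) (hv : F.value p.1 p.2 ≠ 0) :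
    F.mahler ≤ |(F.value p.1 p.2 : ℝ)| * (3 ^ F.dehom.natDegree * ∏ i, F.closeness i p) := by
  obtain ⟨x, y⟩ := p
  simp only at hy hp hv ⊢
  obtain ⟨x', y', hdet, hy0, hyy⟩ := exists_basis_completion hy hp
  set A : Matrix (Fin 2) (Fin 2) ℤ := !![x, x'; y, y'] with hA
  have hdetA : IsUnit A.det := by
    rw [hA, Matrix.det_fin_two_of, hdet]
    exact isUnit_one
  have hEq : F.Equivalent (subst A F) :=
    ⟨Matrix.GeneralLinearGroup.mk'' A hdetA, Or.inl rfl⟩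
  have hyC : (y : ℂ) ≠ 0 := by exact_mod_cast hy.ne'
  have hval : ((F.value x y : ℤ) : ℂ) =
      F.dehom.leadingCoeff * ∏ i, F.linFactor i (x, y) := by
    rw [value_eq_aeval, aeval_eq_prod hF _ _ hyC]
    rfl
  have hL : ∀ i, F.linFactor i (x, y) ≠ 0 := by
    have h : ((F.value x y : ℤ) : ℂ) ≠ 0 := by exact_mod_cast hv
    rw [hval] at h
    intro i
    exact Finset.prod_ne_zero_iff.mp (right_ne_zero_of_mul h) i (Finset.mem_univ i)
  -- L_i is linear, so its value at (x z + x', y z + y') is L_i(x, y) (z + β i): the roots of the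
  -- transformed form are the `-β i`.
  set β : Fin F.dehom.roots.toList.length → ℂ :=
    fun i => F.linFactor i (x', y') / F.linFactor i (x, y) with hβ
  have hdehom : (subst A F).dehom =
      Polynomial.C ((F.value x y : ℤ) : ℂ) * ∏ i, (Polynomial.X + Polynomial.C (β i)) := by
    apply Polynomial.eq_of_infinite_eval_eq
    -- The factorisation of F needs a nonzero second argument, which excludes a single z.
    refine Set.Infinite.mono (s := {z : ℂ | z ≠ -y' / y}) ?_ ?_
    · intro z hz
      have hz' : (y : ℂ) * z + y' ≠ 0 := by
        intro h
        apply hz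
        field_simp
        linear_combination h
      have hev := aeval_eq_prod hF ((x : ℂ) * z + x') ((y : ℂ) * z + y') hz'
      simp only [Set.mem_ofPred_eq, eval_dehom_subst]
      simp only [hA, Matrix.of_apply, Matrix.cons_val', Matrix.cons_val_zero, Matrix.cons_val_one,
        Matrix.cons_val_fin_one]
      rw [hev, Polynomial.eval_mul, Polynomial.eval_C, Polynomial.eval_prod, hval, mul_assoc,
        ← Finset.prod_mul_distrib]
      congr 1
      refine Finset.prod_congr rfl fun i _ => ?_
      have := hL i
      simp only [Polynomial.eval_add, Polynomial.eval_X, Polynomial.eval_C, hβ]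
      field_simp
      simp only [linFactor]
      ring
    · have : {z : ℂ | z ≠ -y' / y} = {(-y' / y : ℂ)}ᶜ := rfl
      rw [this]
      exact (Set.finite_singleton _).infinite_compl
  have hmah : (subst A F).mahler = |(F.value x y : ℝ)| * ∏ i, max 1 ‖β i‖ := by
    rw [mahler, hdehom, Polynomial.mahlerMeasure_mul, Polynomial.mahlerMeasure_const,
      Complex.norm_intCast]
    congr 1
    have := Polynomial.prod_mahlerMeasure_eq_mahlerMeasure_prod
      (Finset.univ.val.map fun i => (Polynomial.X + Polynomial.C (β i)))
    rw [Multiset.map_map] at this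
    refine this.trans ?_
    change ∏ i, _ = _
    refine Finset.prod_congr rfl fun i _ => ?_
    exact Polynomial.mahlerMeasure_X_add_C _
  have hyR : (0 : ℝ) < y := by exact_mod_cast hy
  refine (hmin _ hEq).trans ?_
  rw [hmah, ← F.length_roots]
  refine mul_le_mul_of_nonneg_left ?_ (abs_nonneg _)
  have h3 : (3 : ℝ) ^ F.dehom.roots.toList.length =
      ∏ i : Fin F.dehom.roots.toList.length, 3 := by simp
  rw [h3, ← Finset.prod_mul_distrib]
  refine Finset.prod_le_prod (fun _ _ => by positivity) fun i _ => ?_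
  have hLi := hL i
  have hdetC : (x : ℂ) * y' - x' * y = 1 := by exact_mod_cast hdet
  -- The determinant being 1 isolates the pole; the bound 1 + 2t, with t and 1 both at most the
  -- closeness, yields the constant 3.
  have hβi : β i = y' / y - 1 / (y * F.linFactor i (x, y)) := by
    simp only [hβ]
    field_simp
    simp only [linFactor]
    linear_combination -hdetC
  have hn1 : ‖(y' / y : ℂ)‖ ≤ 1 := by
    rw [norm_div, Complex.norm_intCast, Complex.norm_intCast, abs_of_pos hyR,
      abs_of_nonneg (by exact_mod_cast hy0), div_le_one hyR]
    exact_mod_cast hyy.le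
  have hn2 : ‖(1 / (y * F.linFactor i (x, y)) : ℂ)‖ =
      2 * (1 / (2 * y * ‖F.linFactor i (x, y)‖)) := by
    rw [norm_div, norm_mul, Complex.norm_intCast, abs_of_pos hyR, norm_one]
    have := norm_pos_iff.mpr hLi
    field_simp
  have hn : ‖β i‖ ≤ 1 + 2 * (1 / (2 * y * ‖F.linFactor i (x, y)‖)) := by
    rw [hβi, ← hn2]
    exact (norm_sub_le _ _).trans (by linarith)
  have hc1 : 1 ≤ F.closeness i (x, y) := le_max_left _ _
  have hc2 : 1 / (2 * y * ‖F.linFactor i (x, y)‖) ≤ F.closeness i (x, y) := le_max_right _ _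
  refine max_le ?_ ?_ <;> linarith

/-! ### Gap principle. -/

/-- Gap principle for two primitive points close to the same root. -/
theorem closeness_le_div {F : BinForm} {i : Fin F.dehom.roots.toList.length} {p q : ℤ × ℤ}
    (hp : 0 < p.2) (hpq : p.2 ≤ q.2) (hp1 : Int.gcd p.1 p.2 = 1) (hq1 : Int.gcd q.1 q.2 = 1)
    (hne : p ≠ q) (hq : 1 < F.closeness i q) :
    F.closeness i p ≤ q.2 / p.2 := by
  have hq2 : 0 < q.2 := hp.trans_le hpq
  have hpR : (0 : ℝ) < p.2 := by exact_mod_cast hp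
  have hqR : (0 : ℝ) < q.2 := by exact_mod_cast hq2
  have hpqR : (p.2 : ℝ) ≤ q.2 := by exact_mod_cast hpq
  refine max_le ((one_le_div hpR).mpr hpqR) ?_
  -- Proportional primitive vectors with positive second coordinates coincide.
  have hdet : p.1 * q.2 - q.1 * p.2 ≠ 0 := by
    intro h
    apply hne
    have h1 : p.2 ∣ q.2 := by
      refine (Int.isCoprime_iff_gcd_eq_one.mpr hp1).symm.dvd_of_dvd_mul_left ⟨q.1, ?_⟩
      linarith
    have h2 : q.2 ∣ p.2 := by
      refine (Int.isCoprime_iff_gcd_eq_one.mpr hq1).symm.dvd_of_dvd_mul_left ⟨p.1, ?_⟩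
      linarith
    have h3 : p.2 = q.2 := Int.dvd_antisymm hp.le hq2.le h1 h2
    refine Prod.ext ?_ h3
    rw [h3] at h
    exact mul_right_cancel₀ hq2.ne' (sub_eq_zero.mp h)
  have hdet1 : (1 : ℝ) ≤ ‖((p.1 * q.2 - q.1 * p.2 : ℤ) : ℂ)‖ := by
    rw [Complex.norm_intCast]
    exact_mod_cast Int.one_le_abs hdet
  have hid : ((p.1 * q.2 - q.1 * p.2 : ℤ) : ℂ) =
      F.linFactor i p * q.2 - F.linFactor i q * p.2 := by
    simp only [linFactor]
    push_cast
    ring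
  have htri : (1 : ℝ) ≤ ‖F.linFactor i p‖ * q.2 + ‖F.linFactor i q‖ * p.2 := by
    refine hdet1.trans ?_
    rw [hid]
    refine (norm_sub_le _ _).trans_eq ?_
    rw [norm_mul, norm_mul, Complex.norm_intCast, Complex.norm_intCast, abs_of_pos hpR,
      abs_of_pos hqR]
  have hq' : 1 < 1 / (2 * q.2 * ‖F.linFactor i q‖) := by
    rcases lt_max_iff.mp hq with h | h
    · exact absurd h (lt_irrefl _)
    · exact h
  -- A vanishing factor would make the quotient 0 (division by zero), contradicting `hq'`.
  have hqpos : 0 < 2 * q.2 * ‖F.linFactor i q‖ := by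
    by_contra h
    have := div_nonpos_of_nonneg_of_nonpos zero_le_one (not_lt.mp h)
    linarith
  have hqL : 2 * q.2 * ‖F.linFactor i q‖ < 1 := by
    rwa [lt_div_iff₀ hqpos, one_mul] at hq'
  -- The factor 2 in `closeness` pays off here: the q-term uses up less than half of the
  -- determinant, so the p-term carries the other half.
  have hLp : 1 ≤ 2 * (‖F.linFactor i p‖ * q.2) := by
    nlinarith [mul_le_mul_of_nonneg_left hpqR (norm_nonneg (F.linFactor i q))]
  have hLpos : 0 < ‖F.linFactor i p‖ := by
    rcases (norm_nonneg (F.linFactor i p)).eq_or_lt with h | h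
    · rw [← h] at hLp
      linarith
    · exact h
  rw [div_le_div_iff₀ (by positivity) hpR]
  nlinarith

/-! ### Telescoping and counting. -/

/-- Telescoping along a finite set ordered by `y`, leaving out its last element. -/
theorem exists_prod_erase_le {α : Type*} [DecidableEq α] (y v : α → ℝ) (T : Finset α)
    (hy : ∀ p ∈ T, 1 ≤ y p) (hv0 : ∀ p ∈ T, 0 ≤ v p)
    (hv : ∀ p ∈ T, ∀ q ∈ T, p ≠ q → y p ≤ y q → v p ≤ y q / y p) :
    T = ∅ ∨ ∃ e ∈ T, (∀ p ∈ T, y p ≤ y e) ∧ ∏ p ∈ T.erase e, v p ≤ y e := by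
  induction T using Finset.induction_on_max_value y with
  | empty => exact Or.inl rfl
  | insert a s has hmax ih =>
    right
    refine ⟨a, Finset.mem_insert_self a s, ?_, ?_⟩
    · intro p hp
      rcases Finset.mem_insert.mp hp with rfl | hp
      · exact le_rfl
      · exact hmax p hp
    rw [Finset.erase_insert has]
    have ha := hy a (Finset.mem_insert_self a s)
    rcases ih (fun p hp => hy p (Finset.mem_insert_of_mem hp))
      (fun p hp => hv0 p (Finset.mem_insert_of_mem hp))
      (fun p hp q hq => hv p (Finset.mem_insert_of_mem hp) q (Finset.mem_insert_of_mem hq))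
      with rfl | ⟨e, he, -, hle⟩
    · simpa using ha
    · have hes := Finset.mem_insert_of_mem (a := e) (b := a) he
      have hye : 0 < y e := zero_lt_one.trans_le (hy e hes)
      rw [← Finset.mul_prod_erase s v he]
      have hne : e ≠ a := fun h => has (h ▸ he)
      calc v e * ∏ p ∈ s.erase e, v p ≤ (y a / y e) * y e :=
            mul_le_mul (hv e hes a (Finset.mem_insert_self a s) hne (hmax e he)) hle
              (Finset.prod_nonneg fun p hp =>
                hv0 p (Finset.mem_insert_of_mem (Finset.mem_of_mem_erase hp)))
              (by positivity)
        _ = y a := by field_simp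

/-- If every point of `S` is close to some of the `N` indices, and points close to a common index
satisfy a gap principle, then `S` is small. -/
theorem card_le_of_gap {α : Type*} {N : ℕ} (S : Finset α) (y : α → ℝ)
    (v : Fin N → α → ℝ) (K : ℝ) (hK1 : 1 < K) (hK : 9 ^ N ≤ K)
    (hy1 : ∀ p ∈ S, 1 ≤ y p) (hyK : ∀ p ∈ S, y p ≤ K ^ 5) (hv1 : ∀ i, ∀ p ∈ S, 1 ≤ v i p)
    (hgap : ∀ i, ∀ p ∈ S, ∀ q ∈ S, p ≠ q → y p ≤ y q → 1 < v i q → v i p ≤ y q / y p)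
    (hclose : ∀ p ∈ S, K ≤ 3 ^ N * ∏ i, v i p) : S.card ≤ 11 * N := by
  classical
  -- Points with `v i p = 1` do not affect the product; of the others only the one with largest `y`
  -- has no successor to bound it, and it forms `E`.
  have hlast : ∀ i, ∃ E : Finset α, E.card ≤ 1 ∧ ∏ p ∈ S \ E, v i p ≤ K ^ 5 := by
    intro i
    set T := S.filter fun p => 1 < v i p with hT
    have hTS : T ⊆ S := Finset.filter_subset _ _
    have hout : ∀ p ∈ S, p ∉ T → v i p = 1 := fun p hp hpT =>
      le_antisymm (not_lt.mp fun h => hpT (Finset.mem_filter.mpr ⟨hp, h⟩)) (hv1 i p hp)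
    rcases exists_prod_erase_le y (v i) T (fun p hp => hy1 p (hTS hp))
      (fun p hp => zero_le_one.trans (hv1 i p (hTS hp)))
      (fun p hp q hq hne hle =>
        hgap i p (hTS hp) q (hTS hq) hne hle (Finset.mem_filter.mp hq).2) with h | ⟨e, he, -, hle⟩
    · refine ⟨∅, by simp, ?_⟩
      rw [Finset.sdiff_empty, Finset.prod_eq_one fun p hp => hout p hp (by simp [h])]
      exact one_le_pow₀ hK1.le
    · refine ⟨{e}, by simp, ?_⟩
      rw [← Finset.prod_subset (s₁ := T.erase e)]
      · exact hle.trans (hyK e (hTS he))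
      · intro p hp
        simp only [Finset.mem_sdiff, Finset.mem_singleton]
        exact ⟨hTS (Finset.mem_of_mem_erase hp), Finset.ne_of_mem_erase hp⟩
      · intro p hp hpT
        simp only [Finset.mem_sdiff, Finset.mem_singleton] at hp
        exact hout p hp.1 fun h => hpT (Finset.mem_erase.mpr ⟨hp.2, h⟩)
  choose E hE1 hE using hlast
  set B := Finset.univ.biUnion E with hB
  have hBcard : B.card ≤ N := by
    refine Finset.card_biUnion_le.trans ?_
    refine (Finset.sum_le_sum fun i _ => hE1 i).trans ?_
    simp
  set R := S \ B with hR
  have hRS : R ⊆ S := Finset.sdiff_subset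
  have hprod : ∏ p ∈ R, ∏ i, v i p ≤ K ^ (5 * N) := by
    rw [Finset.prod_comm]
    have : (K : ℝ) ^ (5 * N) = ∏ _i : Fin N, K ^ 5 := by simp [pow_mul]
    rw [this]
    refine Finset.prod_le_prod
      (fun i _ => Finset.prod_nonneg fun p hp => zero_le_one.trans (hv1 i p (hRS hp)))
      fun i _ => ?_
    refine le_trans ?_ (hE i)
    refine Finset.prod_le_prod_of_subset_of_one_le ?_ ?_ ?_
    · exact Finset.sdiff_subset_sdiff le_rfl (Finset.subset_biUnion_of_mem E (Finset.mem_univ i))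
    · exact fun p hp => zero_le_one.trans (hv1 i p (hRS hp))
    · exact fun p hp _ => hv1 i p (Finset.mem_sdiff.mp hp).1
  have hK0 : 0 < K := by linarith
  have hpow : K ^ R.card ≤ (3 ^ N) ^ R.card * K ^ (5 * N) := by
    calc K ^ R.card = ∏ _p ∈ R, K := by simp
      _ ≤ ∏ p ∈ R, (3 ^ N * ∏ i, v i p) :=
          Finset.prod_le_prod (fun _ _ => hK0.le) fun p hp => hclose p (hRS hp)
      _ = (3 ^ N) ^ R.card * ∏ p ∈ R, ∏ i, v i p := by
          rw [Finset.prod_mul_distrib, Finset.prod_const]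
      _ ≤ _ := mul_le_mul_of_nonneg_left hprod (by positivity)
  -- Squaring turns 3 ^ N into 9 ^ N ≤ K, so that only integral powers of K are compared.
  have hpow2 : K ^ (2 * R.card) ≤ K ^ (R.card + 10 * N) := by
    calc K ^ (2 * R.card) = (K ^ R.card) ^ 2 := by ring
      _ ≤ ((3 ^ N) ^ R.card * K ^ (5 * N)) ^ 2 := pow_le_pow_left₀ (by positivity) hpow 2
      _ = (9 ^ N) ^ R.card * K ^ (10 * N) := by
          have : (9 : ℝ) = 3 ^ 2 := by norm_num
          rw [this, mul_pow, ← pow_mul, ← pow_mul, ← pow_mul, ← pow_mul, ← pow_mul]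
          ring_nf
      _ ≤ K ^ R.card * K ^ (10 * N) := by gcongr
      _ = _ := by rw [pow_add]
  have hRcard : 2 * R.card ≤ R.card + 10 * N := (pow_le_pow_iff_right₀ hK1).mp hpow2
  have : S.card ≤ R.card + B.card := by
    have := Finset.le_card_sdiff B S
    rw [← hR] at this
    omega
  omega

/-! ### Size of M / m and the final count. -/

/-- The hypothesis on `m` makes `M / m` exponentially large in the degree. -/
theorem nine_pow_le_mahler_div {n m : ℕ} {F : BinForm} (hn : 2 ≤ n) (hm : 1 ≤ m)
    (hdeg : F.dehom.natDegree = n)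
    (h : (m : ℝ) ≤ ‖F.discr‖ ^ (1 / (2 * ((n : ℝ) - 1))) / Real.exp (200 * n)) :
    9 ^ n ≤ F.mahler / m := by
  have hmR : (0 : ℝ) < m := by exact_mod_cast hm
  have hM0 : 0 ≤ F.mahler := Polynomial.mahlerMeasure_nonneg _
  have hD := F.norm_discr_le (by omega)
  rw [hdeg] at hD
  have hexp : (0 : ℝ) < 1 / (2 * ((n : ℝ) - 1)) := by
    have : (2 : ℝ) ≤ n := by exact_mod_cast hn
    have : (0 : ℝ) < n - 1 := by linarith
    positivity
  have hroot : ‖F.discr‖ ^ (1 / (2 * ((n : ℝ) - 1))) ≤ 2 ^ n * F.mahler := by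
    refine (Real.rpow_le_rpow (norm_nonneg _) hD hexp.le).trans_eq ?_
    have hc : 1 / (2 * ((n : ℝ) - 1)) = ((2 * (n - 1) : ℕ) : ℝ)⁻¹ := by
      rw [one_div]
      push_cast [Nat.cast_sub (by omega : 1 ≤ n)]
      rfl
    rw [hc]
    exact Real.pow_rpow_inv_natCast (by positivity) (by omega)
  -- 18 = 2 · 9: the 2 absorbs the loss in the discriminant bound, the 9 is what the counting needs.
  have hE : (18 : ℝ) ^ n ≤ Real.exp (200 * n) := by
    have : Real.exp (200 * n) = (Real.exp 200) ^ n := by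
      rw [← Real.exp_nat_mul]
      ring_nf
    rw [this]
    refine pow_le_pow_left₀ (by norm_num) ?_ n
    linarith [Real.add_one_le_exp (200 : ℝ)]
  rw [le_div_iff₀ (Real.exp_pos _)] at h
  rw [le_div_iff₀ hmR]
  have h1 : (m : ℝ) * 18 ^ n ≤ 2 ^ n * F.mahler :=
    (mul_le_mul_of_nonneg_left hE hmR.le).trans (h.trans hroot)
  have h18 : (18 : ℝ) ^ n = 2 ^ n * 9 ^ n := by
    rw [← mul_pow]
    norm_num
  rw [h18] at h1
  have h2 : (0 : ℝ) < 2 ^ n := by positivity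
  refine le_of_mul_le_mul_left ?_ h2
  linarith

/-- A uniform bound for finite subsets also yields finiteness of the solution set. The constant
comes from 11 n + 2 ≤ 12 n. -/
theorem card_smallSolutions_le {n m : ℕ} {F : BinForm} (hn : 3 ≤ n) (hm : 1 ≤ m)
    (hF : F.IsHomogeneous n) (hirr : Irreducible (MvPolynomial.map (Int.castRingHom ℚ) F))
    (hmin : F.HasMinimalMahler)
    (h : (m : ℝ) ≤ ‖F.discr‖ ^ (1 / (2 * ((n : ℝ) - 1))) / Real.exp (200 * n))
    (S : Finset (ℤ × ℤ)) (hS : (S : Set (ℤ × ℤ)) ⊆ smallSolutions n m F) :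
    S.card ≤ 12 * n := by
  classical
  have hdeg := natDegree_dehom hF (coeff_single_ne_zero (by omega) hF hirr)
  have hK := nine_pow_le_mahler_div (by omega) hm hdeg h
  have hmR : (0 : ℝ) < m := by exact_mod_cast hm
  have hlen : F.dehom.roots.toList.length = n := F.length_roots.trans hdeg
  have hpos : ∀ p ∈ S.filter (fun p => 0 < p.2), p ∈ smallSolutions n m F ∧ 0 < p.2 :=
    fun p hp => ⟨hS (Finset.mem_filter.mp hp).1, (Finset.mem_filter.mp hp).2⟩
  have hval : ∀ p ∈ smallSolutions n m F, (0 : ℝ) < F.value p.1 p.2 := fun p hp =>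
    lt_of_lt_of_le (by positivity) hp.2.1
  have h1 : (S.filter fun p => 0 < p.2).card ≤ 11 * F.dehom.roots.toList.length := by
    refine card_le_of_gap _ (fun p => (p.2 : ℝ)) F.closeness (F.mahler / m)
      (lt_of_lt_of_le (one_lt_pow₀ (by norm_num) (by omega)) hK) (by rwa [hlen])
      ?_ ?_ ?_ ?_ ?_
    · intro p hp
      exact_mod_cast (hpos p hp).2
    · intro p hp
      exact (hpos p hp).1.2.2.2.2
    · intro i p _
      exact le_max_left _ _
    · intro i p hp q hq hne hle hlt
      exact closeness_le_div (hpos p hp).2 (by exact_mod_cast hle) (hpos p hp).1.1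
        (hpos q hq).1.1 hne hlt
    · intro p hp
      obtain ⟨hps, hp2⟩ := hpos p hp
      have hv := hval p hps
      have hM := mahler_le_value_mul_prod_closeness (by rwa [hdeg]) hmin hp2 hps.1
        (by exact_mod_cast hv.ne')
      rw [div_le_iff₀ hmR, mul_comm]
      rw [hdeg, ← hlen] at hM
      refine hM.trans ?_
      rw [abs_of_pos hv]
      refine mul_le_mul_of_nonneg_right hps.2.2.1.le ?_
      exact mul_nonneg (by positivity)
        (Finset.prod_nonneg fun i _ => zero_le_one.trans (le_max_left _ _))
  have h2 : (S.filter fun p => ¬ 0 < p.2).card ≤ 2 := by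
    -- The basis completion needs y > 0; the only primitive points with y = 0 are (±1, 0).
    have hsub : (S.filter fun p => ¬ 0 < p.2) ⊆ {((1 : ℤ), (0 : ℤ)), (-1, 0)} := by
      rintro ⟨x, y⟩ hp
      obtain ⟨hpS, hy⟩ := Finset.mem_filter.mp hp
      obtain ⟨hg, -, -, hy0, -⟩ := hS hpS
      simp only at hg hy hy0
      obtain rfl : y = 0 := by omega
      rw [Int.gcd_zero_right] at hg
      have : x = 1 ∨ x = -1 := by omega
      rcases this with rfl | rfl <;> simp
    exact (Finset.card_le_card hsub).trans Finset.card_le_two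
  have h3 := Finset.card_filter_add_card_filter_not (s := S) (fun p => 0 < p.2)
  rw [hlen] at h1
  omega

end BinForm

theorem proposition5p1 :
    ∃ c : ℝ, 0 < c ∧
      ∀ (n s m : ℕ) (F : BinForm), 3 ≤ n → 1 ≤ s → 1 ≤ m →
        F ∈ BinForm.classC n (4 * s - 2) →
        F.HasMinimalMahler →
        ((n * (n - 1) : ℕ) : ℝ) ^ (8 * n * (n - 1)) < ‖F.discr‖ →
        (m : ℝ) ≤ ‖F.discr‖ ^ (1 / (2 * ((n : ℝ) - 1))) / Real.exp (200 * n) →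
        (BinForm.smallSolutions n m F).Finite ∧
          ((BinForm.smallSolutions n m F).ncard : ℝ) ≤ c * n := by
  refine ⟨12, by norm_num, fun n s m F hn _ hm hF hmin _ h => ?_⟩
  have hcard := BinForm.card_smallSolutions_le hn hm hF.1 hF.2.1 hmin h
  have hfin : (BinForm.smallSolutions n m F).Finite := by
    by_contra hinf
    obtain ⟨S, hS, hSc⟩ := Set.Infinite.exists_subset_card_eq hinf (12 * n + 1)
    have := hcard S hS
    omega
  refine ⟨hfin, ?_⟩
  rw [Set.ncard_eq_toFinset_card _ hfin]
  exact_mod_cast hcard hfin.toFinset (by simp)
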